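/- Let $f:\mathbb{R}^n\to\mathbb{R}$ and $g_j:\mathbb{R}^n\to\mathbb{R}^{m_j}$, $m_j\ge 1$, $j=1,\dots,q$, be twice continuously differentiable, and consider the nonlinear second-order cone program of minimizing $f(x)$ subject to $g_j(x)\in K_{m_j}$, $j=1,\dots,q$, where $K_{m}=\{z=(z_0,\hat z)\in\mathbb{R}\times\mathbb{R}^{m-1}\mid z_0\ge\|\hat z\|\}$ for $m>1$ and $K_1=[0,\infty)$. Write $\mathcal{K}=K_{m_1}\times\dots\times K_{m_q}$, $g=(g_1,\dots,g_q)$ and $\Omega=\{x\mid g(x)\in\mathcal{K}\}$. For $\bar x\in\Omega$: * Let $I_0(\bar x)=\{j\mid g_j(\bar x)=0\}$ and $I_B(\bar x)=\{j\mid g_j(\bar x)\in\mathrm{bd}(K_{m_j})\setminus\{0\}\}$. Let $\mathcal{C}=\prod_{j\in I_0(\bar x)}K_{m_j}\times\mathbb{R}_+^{|I_B(\bar x)|}$, and let $\mathcal{G}$ be the map with components $\mathcal{G}_j(x)=g_j(x)$ for $j\in I_0(\bar x)$ and $\mathcal{G}_j(x)=[g_j(x)]_0-\|\widehat{g_j(x)}\|$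 for $j\in I_B(\bar x)$. The *facial constant rank property* holds at $\bar x$ if there is a neighborhood $\mathcal{V}$ of $\bar x$ such that, for each face $F$ of $\mathcal{C}$, the dimension of $D\mathcal{G}(x)^T[F^\perp]$ is the same for all $x\in\mathcal{V}$. (A face of $\mathcal{C}$ is a convex subset $F\subseteq\mathcal{C}$ such that whenever $z,w\in\mathcal{C}$ and $\alpha z+(1-\alpha)w\in F$ for some $\alpha\in(0,1)$, then $z,w\in F$.) * $\Lambda(\bar x)$ is the set of all $\bar\lambda=(\bar\lambda_1,\dots,\bar\lambda_q)$ in the polar cone $\mathcal{K}^\circ=\{z\mid\langle z,y\rangle\le 0\ \forall y\in\mathcal{K}\}$ with $\nabla f(\bar x)+Dg(\bar x)^T\bar\lambda=0$ and $\langle g(\bar x),\bar\lambda\rangle=0$. * $C(\bar x)=\{d\in\mathbb{R}^n\mid Dg(\bar x)d\in\mathcal{T}_{\mathcal{K}}(g(\bar x)),\ \langle\nabla f(\bar x),d\rangle=0\}$ is the set of critical directions, where $\mathcal{T}_{\mathcal{K}}$ is the Bouligand tangent cone. * $\sigma(d,\bar x,\bar\lambda)=\sup\{\langle w,\bar\lambda\rangle\mid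 w\in\mathcal{T}^2_{\mathcal{K}}(g(\bar x),Dg(\bar x)d)\}$ (a supremum in $[-\infty,+\infty]$), where $\mathcal{T}^2_{\mathcal{K}}(z,y)=\{w\mid z+ty+\tfrac{t^2}{2}w+o(t^2)\in\mathcal{K}\ \forall t>0\}$ is the inner second-order tangent set, with $o(t^2)$ taken as $t\to0^+$. **Theorem.** Let $\bar x$ be a local minimizer of the program at which the facial constant rank property holds. Then for every $\bar\lambda\in\Lambda(\bar x)$ and every $d\in C(\bar x)$, $$d^T\nabla^2 f(\bar x)d+\sum_{j=1}^q\left\langle D^2g_j(\bar x)[d,d],\bar\lambda_j\right\rangle-\sigma(d,\bar x,\bar\lambda)\ge 0 .$$ -/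

import Mathlib

open Topology Filter
open scoped InnerProductSpace

noncomputable section

namespace NSOCP

/-! ### Nonlinear conic programming -/

section Conic

/-- The Euclidean space `ℝⁿ`. -/
abbrev Rn (n : ℕ) : Type := EuclideanSpace ℝ (Fin n)

variable {n : ℕ} {E : Type*} [NormedAddCommGroup E] [InnerProductSpace ℝ E]

/-- The second-order derivative `D²g(x)[d₁, d₂]`. -/
def secondDeriv {V : Type*} [NormedAddCommGroup V] [NormedSpace ℝ V]
    (g : Rn n → V) (x d₁ d₂ : Rn n) : V :=
  fderiv ℝ (fderiv ℝ g) x d₁ d₂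

/-- The polar `S° = {z | ⟨z, y⟩ ≤ 0 for all y ∈ S}` of a set `S`. -/
def polar (S : Set E) : Set E :=
  {z | ∀ y ∈ S, ⟪z, y⟫_ℝ ≤ 0}

/-- `F` is a face of the convex set `C`: a convex subset of `C` that contains both ends of every
open segment with ends in `C` that meets `F`. -/
def IsFace (C F : Set E) : Prop :=
  Convex ℝ F ∧ IsExtreme ℝ C F

/-- The (inner) second-order tangent set `{w | z + t y + (t²/2) w + o(t²) ∈ S for all t > 0}`
to `S` at `z` in the direction `y`. -/
def secondOrderTangentSet (S : Set E) (z y : E) : Set E :=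
  {w | ∃ r : ℝ → E, r =o[𝓝[>] (0 : ℝ)] (fun t : ℝ => t ^ 2) ∧
    ∀ t : ℝ, 0 < t → z + t • y + (t ^ 2 / 2) • w + r t ∈ S}

/-- The feasible set `{x | g(x) ∈ K}`. -/
def feasibleSet (K : Set E) (g : Rn n → E) : Set (Rn n) :=
  {x | g x ∈ K}

/-- The linearized tangent cone `{d | Dg(x) d ∈ T_K(g(x))}`, where `T_K` is the Bouligand
tangent cone. -/
def linearizedCone (K : Set E) (g : Rn n → E) (x : Rn n) : Set (Rn n) :=
  {d | fderiv ℝ g x d ∈ posTangentConeAt K (g x)}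

/-- The critical directions: those `d` in the linearized tangent cone with `⟨∇f(x), d⟩ = 0`. -/
def criticalCone (f : Rn n → ℝ) (K : Set E) (g : Rn n → E) (x : Rn n) : Set (Rn n) :=
  {d | d ∈ linearizedCone K g x ∧ ⟪gradient f x, d⟫_ℝ = 0}

/-- The set of Lagrange multipliers at `x`: those `μ ∈ K°` with `∇f(x) + Dg(x)ᵀ μ = 0` and
`⟨g(x), μ⟩ = 0`. -/
def lagrangeMultipliers [CompleteSpace E] (f : Rn n → ℝ) (K : Set E) (g : Rn n → E) (x : Rn n) :
    Set E :=
  {μ | μ ∈ polar K ∧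
    gradient f x + ContinuousLinearMap.adjoint (fderiv ℝ g x) μ = 0 ∧ ⟪g x, μ⟫_ℝ = 0}

/-- The sigma-term: the supremum, in the extended reals, of `⟨w, μ⟩` over all `w` in the
second-order tangent set to `K` at `g(x)` in the direction `Dg(x) d`. -/
def sigmaTerm (K : Set E) (g : Rn n → E) (d x : Rn n) (μ : E) : EReal :=
  ⨆ w ∈ secondOrderTangentSet K (g x) (fderiv ℝ g x d), ((⟪w, μ⟫_ℝ : ℝ) : EReal)

end Conic

/-! ### Nonlinear second-order cone programming

The `j`-th block of constraints takes values in `ℝ^(m j + 1)`, with entries numbered from `0`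
to `m j`; so every block has dimension at least one. -/

section SecondOrderCone

/-- The vector `ẑ = (z₁, …, z_k)` for `z = (z₀, z₁, …, z_k)`. -/
def hat {k : ℕ} (z : Rn (k + 1)) : Rn k :=
  WithLp.toLp 2 fun i : Fin k => z i.succ

/-- The second-order cone `{z = (z₀, ẑ) ∈ ℝ^(k+1) | z₀ ≥ ‖ẑ‖}`; for `k = 0` it is `[0, ∞) ⊆ ℝ`. -/
def secondOrderCone (k : ℕ) : Set (Rn (k + 1)) :=
  {z | ‖hat z‖ ≤ z 0}

variable {n q : ℕ} {m : Fin q → ℕ}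

/-- The space `ℝ^(m 1 + 1) × ⋯ × ℝ^(m q + 1)` with its Euclidean inner product. -/
abbrev ProductSpace (m : Fin q → ℕ) : Type :=
  PiLp 2 fun j : Fin q => Rn (m j + 1)

/-- The product of the second-order cones. -/
def productCone (m : Fin q → ℕ) : Set (ProductSpace m) :=
  {z | ∀ j, z j ∈ secondOrderCone (m j)}

/-- The map `x ↦ (g₁(x), …, g_q(x))`. -/
def productMap (g : ∀ j : Fin q, Rn n → Rn (m j + 1)) (x : Rn n) : ProductSpace m :=
  WithLp.toLp 2 fun j => g j x

open Classical in
/-- The indices of the constraints that hit the vertex of their cone at `x`. -/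
def indexZero (g : ∀ j : Fin q, Rn n → Rn (m j + 1)) (x : Rn n) : Finset (Fin q) :=
  Finset.univ.filter fun j => g j x = 0

open Classical in
/-- The indices of the constraints that hit the boundary of their cone, outside the vertex,
at `x`. -/
def indexBdry (g : ∀ j : Fin q, Rn n → Rn (m j + 1)) (x : Rn n) : Finset (Fin q) :=
  Finset.univ.filter fun j => g j x ∈ frontier (secondOrderCone (m j)) \ {0}

/-- The Euclidean space that contains the reduced cone at `xbar`: the product of the spaces
`ℝ^(m j + 1)` over the indices of the vertex constraints, times one copy of `ℝ` for each index of
a boundary constraint. -/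
abbrev ReducedSpace (g : ∀ j : Fin q, Rn n → Rn (m j + 1)) (xbar : Rn n) : Type :=
  WithLp 2 ((PiLp 2 fun j : indexZero g xbar => Rn (m j + 1)) ×
    EuclideanSpace ℝ (indexBdry g xbar))

/-- The reduced cone at `xbar`: the product of the second-order cones of the vertex constraints and
of the nonnegative orthant of the boundary constraints. -/
def reducedCone (g : ∀ j : Fin q, Rn n → Rn (m j + 1)) (xbar : Rn n) :
    Set (ReducedSpace g xbar) :=
  {y | (∀ j : indexZero g xbar, y.fst j ∈ secondOrderCone (m j)) ∧
    ∀ j : indexBdry g xbar, 0 ≤ y.snd j}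

/-- The reduced constraint map at `xbar`, evaluated at `x`: its components are `g_j(x)` for the
vertex constraints and `[g_j(x)]₀ - ‖hat (g_j(x))‖` for the boundary constraints. -/
def reducedMap (g : ∀ j : Fin q, Rn n → Rn (m j + 1)) (xbar x : Rn n) : ReducedSpace g xbar :=
  WithLp.toLp 2
    (WithLp.toLp 2 fun j : indexZero g xbar => g j x,
     WithLp.toLp 2 fun j : indexBdry g xbar => g j x 0 - ‖hat (g j x)‖)

/-- The facial constant rank property at `xbar`: on some neighborhood of `xbar`, for every face `F`
of the reduced cone, the dimension of `D𝒢(x)ᵀ[F^⊥]` does not depend on `x`, where `𝒢` is the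
reduced constraint map. -/
def FacialConstantRank (g : ∀ j : Fin q, Rn n → Rn (m j + 1)) (xbar : Rn n) : Prop :=
  ∃ V ∈ 𝓝 xbar, ∀ F : Set (ReducedSpace g xbar), IsFace (reducedCone g xbar) F →
    ∃ r : ℕ, ∀ x ∈ V,
      Module.finrank ℝ ((Submodule.span ℝ F)ᗮ.map
        (ContinuousLinearMap.adjoint (fderiv ℝ (reducedMap g xbar) x)).toLinearMap) = r

end SecondOrderCone

end NSOCP

end

/-! Near `g(x̄)` the cone `K` is the preimage of the reduced cone `C` under a `C²` map `Φ` with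
`Φ(g(x̄)) = 0`, and `λ = DΦ(g(x̄))ᵀη` for some `η` in the polar of `C`
(`inner_reducedMultiplier_fderiv`). Write `𝒢 = Φ ∘ g`.

For a critical `d`, the vector `y = D𝒢(x̄)d` lies in `C` and is orthogonal to `η`. Hence `η`
vanishes on the span of the smallest face `F` of `C` containing `y`. Constant rank for this one face
gives a curve `ξ` through `x̄`, tangent to `d`, with `𝒢(ξ(t)) ∈ span F`
(`exists_curve_of_constant_rank_orthogonal`). Since `y` is in the relative interior of `F`, `𝒢(ξ(t))
= t(y + o(1))` lies in `C`: the curve is feasible for small `t > 0`, and the Lagrangian `L = f + ⟨η,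
𝒢⟩` equals `f` on it.

Minimality gives `f(x̄) ≤ L(ξ(t))`. As `DL(x̄) = 0`, the straight line may replace `ξ` at cost
`o(t²)`, although `ξ` need be differentiable only at `0`. A path `p(t) ∈ K` with second-order
coefficient `w` satisfies `⟨η, Φ(p(t))⟩ ≤ 0`, and comparing `p(t)` with `g(x̄ + td)` to second order
gives the inequality for that `w`. Thus `σ` is bounded one `w` at a time, without computing
second-order tangent sets or `D²Φ`. -/

namespace NSOCP

/-! ### Second-order expansions. -/

section Calculus

variable {X V : Type*} [NormedAddCommGroup X] [NormedSpace ℝ X]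
  [NormedAddCommGroup V] [NormedSpace ℝ V]

/-- Second-order Taylor expansion along a line. -/
theorem taylor_two_along_line {G : X → V} (hG : ContDiff ℝ 2 G) (x d : X) :
    (fun t : ℝ => G (x + t • d) - G x - t • fderiv ℝ G x d
      - (t ^ 2 / 2) • fderiv ℝ (fderiv ℝ G) x d d) =o[𝓝 0] fun t : ℝ => t ^ 2 := by
  have hline : ∀ t : ℝ, HasDerivAt (fun t : ℝ => x + t • d) d t := fun t => by
    simpa using ((hasDerivAt_id t).smul_const d).const_add x
  have hG' : Differentiable ℝ (fderiv ℝ G) :=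
    (hG.fderiv_right (m := 1) (by norm_num)).differentiable (by norm_num)
  have h1 : ∀ t : ℝ, HasDerivAt (fun t : ℝ => G (x + t • d)) (fderiv ℝ G (x + t • d) d) t :=
    fun t => ((hG.differentiable (by norm_num)) _).hasFDerivAt.comp_hasDerivAt t (hline t)
  have h2 : HasDerivAt (fun t : ℝ => fderiv ℝ G (x + t • d)) (fderiv ℝ (fderiv ℝ G) x d) 0 := by
    exact (hG' x).hasFDerivAt.comp_hasDerivAt_of_eq (0 : ℝ) (hline 0) (by simp)
  have h3 : HasDerivAt (fun t : ℝ => fderiv ℝ G (x + t • d) d)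
      (fderiv ℝ (fderiv ℝ G) x d d) 0 := by
    simpa using h2.clm_apply (hasDerivAt_const (0 : ℝ) d)
  -- The derivative of the remainder is `o(t)`, by differentiability of `t ↦ DG(x + td)d` at `0`;
  -- this raises the order of the remainder by one.
  have key := convex_univ.isLittleO_pow_succ_real (x₀ := (0 : ℝ)) (n := 1) (Set.mem_univ _)
    (f := fun t : ℝ => G (x + t • d) - G x - t • fderiv ℝ G x d
      - (t ^ 2 / 2) • fderiv ℝ (fderiv ℝ G) x d d)
    (f' := fun t : ℝ => fderiv ℝ G (x + t • d) d - fderiv ℝ G x d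
      - t • fderiv ℝ (fderiv ℝ G) x d d) (fun t _ => ?_) ?_
  · simpa using key
  · refine HasDerivAt.hasDerivWithinAt ?_
    have h4 : HasDerivAt (fun t : ℝ => t • fderiv ℝ G x d) (fderiv ℝ G x d) t := by
      simpa using (hasDerivAt_id t).smul_const (fderiv ℝ G x d)
    have h5 : HasDerivAt (fun t : ℝ => (t ^ 2 / 2) • fderiv ℝ (fderiv ℝ G) x d d)
        (t • fderiv ℝ (fderiv ℝ G) x d d) t := by
      have : HasDerivAt (fun t : ℝ => t ^ 2 / 2) t t := by
        simpa using (hasDerivAt_pow 2 t).div_const 2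
      exact this.smul_const _
    exact (((h1 t).sub_const _).sub h4).sub h5
  · have := hasDerivAt_iff_isLittleO.1 h3
    simpa using this

/-- Near a critical point, a `C²` function changes by `o(t²)` between two points that are at
distance `O(t)` from the critical point and `o(t)` from each other. -/
theorem isLittleO_sq_of_fderiv_eq_zero {L : X → V} {x : X} (hL : ContDiffAt ℝ 2 L x)
    (hL0 : fderiv ℝ L x = 0) {l : Filter ℝ} (hl : l ≤ 𝓝 0) {a b : ℝ → X}
    (ha : (fun t => a t - x) =O[l] fun t : ℝ => t) (hb : (fun t => b t - x) =O[l] fun t : ℝ => t)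
    (hab : (fun t => a t - b t) =o[l] fun t : ℝ => t) :
    (fun t => L (a t) - L (b t)) =o[l] fun t : ℝ => t ^ 2 := by
  have hd : DifferentiableAt ℝ (fderiv ℝ L) x :=
    (hL.fderiv_right (m := 1) (by norm_num)).differentiableAt (by norm_num)
  obtain ⟨C, hC⟩ := hd.hasFDerivAt.isBigO_sub.bound
  have hnear : ∀ᶠ y in 𝓝 x, DifferentiableAt ℝ L y :=
    (hL.eventually (by simp)).mono fun y hy => hy.differentiableAt (by norm_num)
  obtain ⟨ε, hε, hball⟩ := Metric.eventually_nhds_iff_ball.1 (hC.and hnear)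
  obtain ⟨A, hA⟩ := ha.bound
  obtain ⟨B, hB⟩ := hb.bound
  set M := max (max A B) 1 with hM
  have hsmall : ∀ᶠ t in l, M * ‖t‖ < ε := by
    have : Tendsto (fun t : ℝ => M * ‖t‖) l (𝓝 0) := by
      have h : Tendsto (fun t : ℝ => M * ‖t‖) (𝓝 0) (𝓝 (M * ‖(0 : ℝ)‖)) := by
        apply Continuous.tendsto; fun_prop
      simpa using h.mono_left hl
    exact this.eventually (gt_mem_nhds hε)
  have hbound : (fun t => L (a t) - L (b t)) =O[l] fun t => ‖t‖ * ‖a t - b t‖ := by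
    refine Asymptotics.IsBigO.of_bound (|C| * M) ?_
    filter_upwards [hA, hB, hsmall] with t hAt hBt ht
    have hM1 : A ≤ M := (le_max_left _ _).trans (le_max_left _ _)
    have hM2 : B ≤ M := (le_max_right _ _).trans (le_max_left _ _)
    have ham : a t ∈ Metric.closedBall x (M * ‖t‖) := by
      rw [mem_closedBall_iff_norm]
      exact hAt.trans (by gcongr)
    have hbm : b t ∈ Metric.closedBall x (M * ‖t‖) := by
      rw [mem_closedBall_iff_norm]
      exact hBt.trans (by gcongr)
    -- Both points lie within `M|t|` of `x`, where `DL = O(t)` because `DL(x) = 0`; the mean value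
    -- inequality multiplies this by the `o(t)` distance.
    have := (convex_closedBall x (M * ‖t‖)).norm_image_sub_le_of_norm_fderiv_le (𝕜 := ℝ) (f := L)
      (C := |C| * M * ‖t‖) (fun y hy => (hball y (Metric.closedBall_subset_ball ht hy)).2)
      (fun y hy => ?_) hbm ham
    · simpa [mul_assoc] using this
    · have h1 := (hball y (Metric.closedBall_subset_ball ht hy)).1
      rw [hL0, sub_zero] at h1
      refine h1.trans ?_
      rw [mul_assoc]
      have := mem_closedBall_iff_norm.1 hy
      have := le_abs_self C
      gcongr
  refine hbound.trans_isLittleO ?_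
  have := (Asymptotics.isBigO_refl (fun t : ℝ => ‖t‖) l).mul_isLittleO hab.norm_norm
  refine this.trans_isBigO ?_
  refine Asymptotics.IsBigO.of_bound 1 (.of_forall fun t => ?_)
  simp [pow_two]

end Calculus

/-! ### Curves in level sets of constant-rank maps. -/

section ConstantRank

variable {X V : Type*} [NormedAddCommGroup X] [NormedSpace ℝ X] [FiniteDimensional ℝ X]
  [NormedAddCommGroup V] [NormedSpace ℝ V] [FiniteDimensional ℝ V]

/-- If the derivative of `H` has constant rank near `x`, then each direction in its kernel at `x`
is tangent to a curve in the level set of `H` through `x`. -/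
theorem exists_curve_of_constant_rank {H : X → V} {x : X} (hH : ContDiffAt ℝ 1 H x) {r : ℕ}
    (hrank : ∀ᶠ y in 𝓝 x, Module.finrank ℝ (fderiv ℝ H y).range = r)
    {d : X} (hd : fderiv ℝ H x d = 0) :
    ∃ ξ : ℝ → X, ξ 0 = x ∧ HasDerivAt ξ d 0 ∧ ∀ᶠ t in 𝓝 0, H (ξ t) = H x := by
  set A := fderiv ℝ H x with hAdef
  let R : Submodule ℝ V := A.range
  obtain ⟨π₀, hπ₀⟩ := R.subtype.exists_leftInverse_of_injective (Submodule.ker_subtype R)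
  obtain ⟨S₀, hS₀⟩ := A.toLinearMap.rangeRestrict.exists_rightInverse_of_surjective
    (LinearMap.range_rangeRestrict _)
  let π : V →L[ℝ] R := π₀.toContinuousLinearMap
  let S : R →L[ℝ] X := S₀.toContinuousLinearMap
  have hπ : ∀ v : R, π v = v := fun v => LinearMap.congr_fun hπ₀ v
  have hAS : ∀ u : R, A (S u) = u := fun u => congrArg Subtype.val (LinearMap.congr_fun hS₀ u)
  -- `π` projects onto the range `R` of `A` and `S` is a right inverse of `A` on `R`. Since `A d =
  -- 0` and `π A S = id`, the map `Ψ` below has the identity as derivative at `0`; the curve is the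
  -- image under `ι` of its local inverse along `(t, 0)`.
  let ι : ℝ × R → X := fun p => x + p.1 • d + S p.2
  let ι' : ℝ × R →L[ℝ] X :=
    (ContinuousLinearMap.fst ℝ ℝ R).smulRight d + S.comp (ContinuousLinearMap.snd ℝ ℝ R)
  have hι : ∀ p, HasFDerivAt ι ι' p := fun p => by
    have := (ι'.hasFDerivAt (x := p)).const_add x
    refine this.congr_of_eventuallyEq (.of_forall fun q => ?_)
    simp [ι, ι', add_assoc]
  have hι0 : ι 0 = x := by simp [ι]
  have hιc : ContDiff ℝ 1 ι := by
    have : ContDiff ℝ 1 (fun p => x + ι' p) := by fun_prop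
    convert this using 2 with p
    simp [ι, ι', add_assoc]
  let Ψ : ℝ × R → ℝ × R := fun p => (p.1, π (H (ι p) - H x))
  have hΨ0 : Ψ 0 = 0 := by simp [Ψ, hι0]
  have hΨc : ContDiffAt ℝ 1 Ψ 0 := by
    refine contDiffAt_fst.prodMk (π.contDiff.contDiffAt.comp _ (ContDiffAt.sub ?_ contDiffAt_const))
    exact ContDiffAt.comp _ (hι0 ▸ hH) hιc.contDiffAt
  have hHd : HasFDerivAt H A x := (hH.differentiableAt (by norm_num)).hasFDerivAt
  have hΨ' : HasFDerivAt Ψ ((ContinuousLinearEquiv.refl ℝ (ℝ × R) : _ ≃L[ℝ] _) :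
      ℝ × R →L[ℝ] ℝ × R) 0 := by
    have h1 : HasFDerivAt (fun p => π (H (ι p) - H x)) (π.comp (A.comp ι')) (0 : ℝ × R) := by
      have h2 : HasFDerivAt (fun p => H (ι p)) (A.comp ι') (0 : ℝ × R) :=
        HasFDerivAt.comp (0 : ℝ × R) (hι0 ▸ hHd) (hι 0)
      exact π.hasFDerivAt.comp (0 : ℝ × R) (h2.sub_const _)
    have h3 : ((ContinuousLinearEquiv.refl ℝ (ℝ × R) : _ ≃L[ℝ] _) : ℝ × R →L[ℝ] ℝ × R) =
        (ContinuousLinearMap.fst ℝ ℝ R).prod (π.comp (A.comp ι')) := by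
      refine ContinuousLinearMap.ext fun p => Prod.ext ?_ ?_
      · simp
      · simp [ι', hd, hAS, hπ]
    rw [h3]
    exact hasFDerivAt_fst.prodMk h1
  have hs := hΨc.hasStrictFDerivAt' hΨ' one_ne_zero
  set ψ := hΨc.localInverse hΨ' one_ne_zero with hψ
  have hψc : ContDiffAt ℝ 1 ψ 0 := hΨ0 ▸ hΨc.to_localInverse hΨ' one_ne_zero
  have hψ0 : ψ 0 = 0 := by
    have := hΨc.localInverse_apply_image hΨ' one_ne_zero
    rwa [hΨ0] at this
  have hψd : HasFDerivAt ψ (ContinuousLinearMap.id ℝ (ℝ × R)) 0 := by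
    have := hs.to_localInverse.hasFDerivAt
    rw [hΨ0] at this
    exact this
  have hinv : ∀ᶠ p in 𝓝 (0 : ℝ × R), Ψ (ψ p) = p := by
    have := hs.eventually_right_inverse
    rw [hΨ0] at this
    exact this
  have hj : Tendsto (fun t : ℝ => (t, (0 : R))) (𝓝 0) (𝓝 0) := by
    have : Continuous fun t : ℝ => (t, (0 : R)) := by fun_prop
    exact this.tendsto 0
  have hjd : ∀ t : ℝ, HasDerivAt (fun t : ℝ => (t, (0 : R))) (1, 0) t := fun t =>
    (hasDerivAt_id t).prodMk (hasDerivAt_const t 0)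
  refine ⟨fun t => ι (ψ (t, 0)), by simp [Prod.mk_zero_zero, hψ0, hι0], ?_, ?_⟩
  · have h1 : HasDerivAt (fun t : ℝ => ψ (t, 0)) (1, 0) 0 := by
      exact HasFDerivAt.comp_hasDerivAt (0 : ℝ) (l := ψ) (f := fun t : ℝ => (t, (0 : R)))
        hψd (hjd 0)
    have h2 : ι' (1, 0) = d := by simp [ι']
    rw [← h2]
    exact (hι (ψ (0, 0))).comp_hasDerivAt (0 : ℝ) h1
  · have hξ : Tendsto (fun t : ℝ => ι (ψ (t, 0))) (𝓝 0) (𝓝 x) := by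
      have h1 : Tendsto (fun t : ℝ => ψ (t, 0)) (𝓝 0) (𝓝 0) := by
        have := hψc.continuousAt.tendsto.comp hj
        rwa [hψ0] at this
      have := (hιc.continuous.tendsto 0).comp h1
      rwa [hι0] at this
    have hunit : ∀ᶠ y in 𝓝 x, IsUnit (π.comp ((fderiv ℝ H y).comp S)) := by
      have hcont : ContinuousAt (fun y => π.comp ((fderiv ℝ H y).comp S)) x := by
        have h1 : ContinuousAt (fderiv ℝ H) x :=
          (hH.fderiv_right (m := 0) (by norm_num)).continuousAt
        exact continuousAt_const.clm_comp (h1.clm_comp continuousAt_const)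
      have h0 : π.comp ((fderiv ℝ H x).comp S) = 1 := by
        ext u
        simp [← hAdef, hAS, hπ]
      have : {T : R →L[ℝ] R | IsUnit T} ∈ 𝓝 (π.comp ((fderiv ℝ H x).comp S)) := by
        rw [h0]
        exact (Units.isOpen (R := R →L[ℝ] R)).mem_nhds (by exact isUnit_one)
      exact hcont.eventually this
    -- Constant rank enters here: near `x`, `π` maps the range of `DH(y)` onto `R`, and equal
    -- dimensions make it injective there. So a velocity of `H` along the curve that `π` kills is
    -- zero.
    have hker : ∀ᶠ y in 𝓝 x, ∀ v, π (fderiv ℝ H y v) = 0 → fderiv ℝ H y v = 0 := by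
      filter_upwards [hunit, hrank] with y hu hr v hv
      let T : (fderiv ℝ H y).range →ₗ[ℝ] R := π.toLinearMap.domRestrict _
      have hsurj : Function.Surjective T := fun u => by
        obtain ⟨T', hT'⟩ := hu
        refine ⟨⟨fderiv ℝ H y (S ((↑T'⁻¹ : R →L[ℝ] R) u)), LinearMap.mem_range_self _ _⟩, ?_⟩
        have : ((T' : R →L[ℝ] R) * (↑T'⁻¹ : R →L[ℝ] R)) u = u := by simp
        rw [hT'] at this
        exact this
      have hfr : Module.finrank ℝ (fderiv ℝ H y).range = Module.finrank ℝ R :=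
        hr.trans hrank.self_of_nhds.symm
      have hinj := (LinearMap.injective_iff_surjective_of_finrank_eq_finrank hfr).2 hsurj
      have : (⟨fderiv ℝ H y v, LinearMap.mem_range_self _ v⟩ : (fderiv ℝ H y).range) = 0 := by
        apply hinj
        rw [map_zero]
        exact hv
      exact congrArg Subtype.val this
    have hdiff : ∀ᶠ t in 𝓝 (0 : ℝ), DifferentiableAt ℝ ψ (t, 0) :=
      hj.eventually ((hψc.eventually (by simp)).mono fun p hp => hp.differentiableAt (by norm_num))
    have hHdiff : ∀ᶠ y in 𝓝 x, DifferentiableAt ℝ H y :=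
      (hH.eventually (by simp)).mono fun y hy => hy.differentiableAt (by norm_num)
    have hpi : ∀ᶠ t in 𝓝 (0 : ℝ), π (H (ι (ψ (t, 0))) - H x) = 0 := by
      filter_upwards [hj.eventually hinv] with t ht
      exact congrArg Prod.snd ht
    obtain ⟨ε, hε, hball⟩ := Metric.eventually_nhds_iff_ball.1
      (((hξ.eventually hker).and (hξ.eventually hHdiff)).and (hdiff.and hpi.eventually_nhds))
    have hder : ∀ t ∈ Metric.ball (0 : ℝ) ε, HasDerivAt (fun t => H (ι (ψ (t, 0)))) 0 t := by
      intro t ht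
      obtain ⟨⟨hk, hD⟩, hψt, hπt⟩ := hball t ht
      have h1 := HasFDerivAt.comp_hasDerivAt t (l := ψ) (f := fun t : ℝ => (t, (0 : R)))
        hψt.hasFDerivAt (hjd t)
      have h2 := (hι (ψ (t, 0))).comp_hasDerivAt t h1
      have h3 := hD.hasFDerivAt.comp_hasDerivAt t h2
      have h4 := π.hasFDerivAt.comp_hasDerivAt t (h3.sub_const (H x))
      have h5 : HasDerivAt (fun t : ℝ => π (H (ι (ψ (t, 0))) - H x)) 0 t :=
        (hasDerivAt_const t (0 : R)).congr_of_eventuallyEq hπt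
      have h6 := hk _ (h4.unique h5)
      rw [← h6]
      exact h3
    filter_upwards [Metric.ball_mem_nhds (0 : ℝ) hε] with t ht
    have := Metric.isOpen_ball.is_const_of_deriv_eq_zero
      (convex_ball (0 : ℝ) ε).isPreconnected
      (fun s hs => (hder s hs).differentiableAt.differentiableWithinAt)
      (fun s hs => (hder s hs).deriv) ht (Metric.mem_ball_self hε)
    simpa [Prod.mk_zero_zero, hψ0, hι0] using this

end ConstantRank

end NSOCP

namespace NSOCP

/-! ### The minimal face of a point in a convex cone. -/

section Faces

variable {Y : Type*} [NormedAddCommGroup Y] [InnerProductSpace ℝ Y]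

/-- The smallest face of the convex cone `C` that contains `y`. -/
def minimalFace (C : Set Y) (y : Y) : Set Y :=
  {z | z ∈ C ∧ ∃ ε : ℝ, 0 < ε ∧ y - ε • z ∈ C}

variable {C : Set Y} {y : Y}

theorem sub_smul_mem_of_le (hadd : ∀ a ∈ C, ∀ b ∈ C, a + b ∈ C)
    (hsmul : ∀ c : ℝ, 0 ≤ c → ∀ a ∈ C, c • a ∈ C) (hy : y ∈ C) {z : Y} {ε δ : ℝ}
    (hε : 0 < ε) (h : y + ε • z ∈ C) (hδ : 0 ≤ δ) (hle : δ ≤ ε) : y + δ • z ∈ C := by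
  have h1 := hadd _ (hsmul (δ / ε) (by positivity) _ h) _
    (hsmul (1 - δ / ε) (by rw [sub_nonneg, div_le_one hε]; exact hle) _ hy)
  have h2 : δ = δ / ε * ε := by field_simp
  convert h1 using 1
  rw [smul_add, smul_smul, ← h2]
  module

theorem mem_minimalFace_self (hsmul : ∀ c : ℝ, 0 ≤ c → ∀ a ∈ C, c • a ∈ C) (hy : y ∈ C) :
    y ∈ minimalFace C y :=
  ⟨hy, 1, one_pos, by simpa using hsmul 0 le_rfl y hy⟩

/-- For extremality: if `u = az + bw` and `y - εu ∈ C`, then `y - εaz = (y - εu) + εbw` is again in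
`C`. -/
theorem isFace_minimalFace (hadd : ∀ a ∈ C, ∀ b ∈ C, a + b ∈ C)
    (hsmul : ∀ c : ℝ, 0 ≤ c → ∀ a ∈ C, c • a ∈ C) (hy : y ∈ C) :
    IsFace C (minimalFace C y) := by
  refine ⟨?_, fun z hz => hz.1, ?_⟩
  · rintro z ⟨hz, ε, hε, hzε⟩ w ⟨hw, δ, hδ, hwδ⟩ a b ha hb hab
    refine ⟨hadd _ (hsmul a ha z hz) _ (hsmul b hb w hw), min ε δ, lt_min hε hδ, ?_⟩
    have h1 := sub_smul_mem_of_le (z := -z) hadd hsmul hy hε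
      (by simpa [sub_eq_add_neg] using hzε) (lt_min hε hδ).le (min_le_left _ _)
    have h2 := sub_smul_mem_of_le (z := -w) hadd hsmul hy hδ
      (by simpa [sub_eq_add_neg] using hwδ) (lt_min hε hδ).le (min_le_right _ _)
    have h3 := hadd _ (hsmul a ha _ h1) _ (hsmul b hb _ h2)
    convert h3 using 1
    obtain rfl : a = 1 - b := by linarith
    module
  · rintro z hz w hw u ⟨hu, ε, hε, huε⟩ ⟨a, b, ha, hb, hab, rfl⟩
    refine ⟨hz, ε * a, by positivity, ?_⟩
    have := hadd _ huε _ (hsmul (ε * b) (by positivity) w hw)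
    convert this using 1
    module

/-- Both `z` and `y - εz` lie in `C`, and `η` takes the values `⟪η, z⟫` and `-ε⟪η, z⟫` on them;
neither is positive. -/
theorem inner_eq_zero_of_mem_minimalFace {η : Y} (hη : ∀ z ∈ C, ⟪η, z⟫_ℝ ≤ 0)
    (hηy : ⟪η, y⟫_ℝ = 0) {z : Y} (hz : z ∈ minimalFace C y) : ⟪η, z⟫_ℝ = 0 := by
  obtain ⟨hzC, ε, hε, h⟩ := hz
  have h1 := hη _ h
  rw [inner_sub_right, inner_smul_right, hηy] at h1
  have := hη _ hzC
  nlinarith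

/-- The directions in which one can move both ways from `y` inside `C` form a linear subspace, which
contains the minimal face. -/
theorem exists_add_smul_mem_of_mem_span (hadd : ∀ a ∈ C, ∀ b ∈ C, a + b ∈ C)
    (hsmul : ∀ c : ℝ, 0 ≤ c → ∀ a ∈ C, c • a ∈ C) (hy : y ∈ C) {z : Y}
    (hz : z ∈ Submodule.span ℝ (minimalFace C y)) :
    ∃ δ : ℝ, 0 < δ ∧ ∀ s : ℝ, |s| ≤ δ → y + s • z ∈ C := by
  have hred : ∀ (z : Y) (ε : ℝ), 0 < ε → y + ε • z ∈ C → y - ε • z ∈ C →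
      ∀ s : ℝ, |s| ≤ ε → y + s • z ∈ C := by
    intro z ε hε h1 h2 s hs
    rcases le_total 0 s with h | h
    · exact sub_smul_mem_of_le hadd hsmul hy hε h1 h (by rwa [abs_of_nonneg h] at hs)
    · have := sub_smul_mem_of_le (z := -z) (δ := -s) hadd hsmul hy hε
        (by simpa [sub_eq_add_neg] using h2) (by linarith) (by rwa [abs_of_nonpos h] at hs)
      simpa using this
  induction hz using Submodule.span_induction with
  | mem z hz =>
    obtain ⟨hzC, ε, hε, h⟩ := hz
    exact ⟨ε, hε, hred z ε hε (hadd _ hy _ (hsmul ε hε.le z hzC)) h⟩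
  | zero => exact ⟨1, one_pos, fun s _ => by simpa using hy⟩
  | add z w _ _ hz hw =>
    obtain ⟨ε, hε, h1⟩ := hz
    obtain ⟨δ, hδ, h2⟩ := hw
    refine ⟨min ε δ / 2, by positivity, fun s hs => ?_⟩
    have h3 := min_le_left ε δ
    have h4 := min_le_right ε δ
    have h5 : |2 * s| = 2 * |s| := by rw [abs_mul]; simp
    have := hadd _ (hsmul (1 / 2) (by norm_num) _ (h1 (2 * s) (by linarith))) _
      (hsmul (1 / 2) (by norm_num) _ (h2 (2 * s) (by linarith)))
    convert this using 1
    module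
  | smul a z _ hz =>
    obtain ⟨ε, hε, h⟩ := hz
    refine ⟨ε / (|a| + 1), by positivity, fun s hs => ?_⟩
    rw [smul_smul]
    refine h _ ?_
    rw [abs_mul]
    calc |s| * |a| ≤ ε / (|a| + 1) * (|a| + 1) := by gcongr; linarith
      _ = ε := by field_simp

/-- The point `y` lies in the relative interior of its minimal face. -/
theorem eventually_add_mem_of_mem_span [FiniteDimensional ℝ Y]
    (hadd : ∀ a ∈ C, ∀ b ∈ C, a + b ∈ C)
    (hsmul : ∀ c : ℝ, 0 ≤ c → ∀ a ∈ C, c • a ∈ C) (hy : y ∈ C) :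
    ∀ᶠ z in 𝓝 (0 : Y), z ∈ Submodule.span ℝ (minimalFace C y) → y + z ∈ C := by
  set W := Submodule.span ℝ (minimalFace C y)
  let b := Module.finBasis ℝ W
  set N := Module.finrank ℝ W
  choose δ hδ hmem using fun i => exists_add_smul_mem_of_mem_span hadd hsmul hy (b i).2
  -- The factor `N` is there because `y + ∑ cᵢbᵢ` is the average of the `N` points `y + N cᵢ bᵢ`,
  -- each in `C` by the choice of `δ i`.
  have hev : ∀ᶠ w in 𝓝 (0 : W), ∀ i, |(N : ℝ) * b.repr w i| ≤ δ i := by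
    refine eventually_all.2 fun i => ?_
    have hc : Continuous fun w : W => |(N : ℝ) * b.repr w i| :=
      (LinearMap.continuous_of_finiteDimensional ((N : ℝ) • b.coord i)).abs
    have := hc.tendsto 0
    simp only [map_zero, Finsupp.coe_zero, Pi.zero_apply, mul_zero, abs_zero] at this
    exact (this.eventually (gt_mem_nhds (hδ i))).mono fun w hw => hw.le
  rw [nhds_induced, eventually_comap] at hev
  filter_upwards [hev] with z hz hzW
  have hz' := hz ⟨z, hzW⟩ rfl
  rcases Nat.eq_zero_or_pos N with hN | hN
  · have : Subsingleton W := Module.finrank_zero_iff.1 hN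
    have h0 : (⟨z, hzW⟩ : W) = 0 := Subsingleton.elim _ _
    have : z = 0 := congrArg Subtype.val h0
    simpa [this] using hy
  · have hN' : (N : ℝ) ≠ 0 := by positivity
    have hsum : z = ∑ i, b.repr ⟨z, hzW⟩ i • (b i : Y) := by
      have := congrArg W.subtype (b.sum_repr ⟨z, hzW⟩).symm
      rwa [map_sum] at this
    have hzero : (0 : Y) ∈ C := by simpa using hsmul 0 le_rfl y hy
    have hsumC : ∀ (s : Finset (Fin N)) (u : Fin N → Y), (∀ i, u i ∈ C) → ∑ i ∈ s, u i ∈ C := by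
      intro s u hu
      induction s using Finset.induction_on with
      | empty => simpa using hzero
      | insert i s his ih => rw [Finset.sum_insert his]; exact hadd _ (hu i) _ ih
    have := hsumC Finset.univ
      (fun i => (1 / (N : ℝ)) • (y + ((N : ℝ) * b.repr ⟨z, hzW⟩ i) • (b i : Y)))
      (fun i => hsmul _ (by positivity) _ (hmem i _ (hz' i)))
    convert this using 1
    simp only [smul_add, Finset.sum_add_distrib, smul_smul, Finset.sum_const, Finset.card_univ,
      Fintype.card_fin]
    conv_lhs => rw [hsum]
    congr 1
    · rw [← Nat.cast_smul_eq_nsmul ℝ, smul_smul]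
      field_simp
      simp
    · refine Finset.sum_congr rfl fun i _ => ?_
      congr 1
      field_simp

end Faces

end NSOCP

namespace NSOCP

/-! ### The second-order condition for a set reducible to a cone. -/

section Reducible

variable {X E Y : Type*} [NormedAddCommGroup X] [InnerProductSpace ℝ X] [FiniteDimensional ℝ X]
  [NormedAddCommGroup E] [InnerProductSpace ℝ E]
  [NormedAddCommGroup Y] [InnerProductSpace ℝ Y] [FiniteDimensional ℝ Y]

/-- If `DG(y)ᵀ[Uᗮ]` has constant dimension for `y` near `x`, then each direction `d` with
`DG(x) d ∈ U` is tangent to a curve on which `G - G(x)` stays in `U`. -/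
theorem exists_curve_of_constant_rank_orthogonal {G : X → Y} {x : X} (hG : ContDiffAt ℝ 1 G x)
    (U : Submodule ℝ Y) {r : ℕ}
    (hrank : ∀ᶠ y in 𝓝 x, Module.finrank ℝ
      (Uᗮ.map (ContinuousLinearMap.adjoint (fderiv ℝ G y)).toLinearMap) = r)
    {d : X} (hd : fderiv ℝ G x d ∈ U) :
    ∃ ξ : ℝ → X, ξ 0 = x ∧ HasDerivAt ξ d 0 ∧ ∀ᶠ t in 𝓝 0, G (ξ t) - G x ∈ U := by
  let P : Y →L[ℝ] Uᗮ := Uᗮ.orthogonalProjectionOnto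
  have hPmem : ∀ z, P z = 0 ↔ z ∈ U := fun z => by
    rw [Submodule.orthogonalProjectionOnto_eq_zero_iff, Submodule.orthogonal_orthogonal]
  have hdiff : ∀ᶠ y in 𝓝 x, DifferentiableAt ℝ G y :=
    (hG.eventually (by simp)).mono fun y hy => hy.differentiableAt (by norm_num)
  have hfd : ∀ᶠ y in 𝓝 x, fderiv ℝ (fun y => P (G y)) y = P.comp (fderiv ℝ G y) :=
    hdiff.mono fun y hy => (P.hasFDerivAt.comp y hy.hasFDerivAt).fderiv
  have hr : ∀ᶠ y in 𝓝 x, Module.finrank ℝ (fderiv ℝ (fun y => P (G y)) y).range = r := by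
    filter_upwards [hfd, hrank] with y hy hr
    -- `DG(y)ᵀ[Uᗮ]` is the range of the adjoint of `P ∘ DG(y)`, and adjoint maps have equal rank.
    have hadj : (ContinuousLinearMap.adjoint (fderiv ℝ G y)).toLinearMap ∘ₗ Uᗮ.subtype =
        LinearMap.adjoint (P.comp (fderiv ℝ G y)).toLinearMap := by
      rw [LinearMap.eq_adjoint_iff]
      intro u v
      simp [P, ContinuousLinearMap.adjoint_inner_left]
    rw [hy, ← hr, ← LinearMap.finrank_range_adjoint, ← hadj, LinearMap.range_comp,
      Submodule.range_subtype]
  have hd' : fderiv ℝ (fun y => P (G y)) x d = 0 := by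
    rw [hfd.self_of_nhds]
    exact (hPmem _).2 hd
  obtain ⟨ξ, h0, h1, h2⟩ := exists_curve_of_constant_rank
    (P.contDiff.contDiffAt.comp x hG) hr hd'
  refine ⟨ξ, h0, h1, h2.mono fun t ht => ?_⟩
  rw [← hPmem, map_sub, sub_eq_zero]
  exact ht

/-- The second-order necessary condition for a constraint `g(x) ∈ K` whose set `K` is locally the
preimage of a closed convex cone under a `C²` map `Φ` that vanishes at `g(x)`. -/
theorem inner_secondOrderTangent_le_of_constant_rank
    {f : X → ℝ} (hf : ContDiff ℝ 2 f) {g : X → E} (hg : ContDiff ℝ 2 g) {x : X} {K : Set E}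
    {Φ : E → Y} (hΦ : ContDiffAt ℝ 2 Φ (g x)) (hΦ0 : Φ (g x) = 0)
    {C : Set Y} (hadd : ∀ a ∈ C, ∀ b ∈ C, a + b ∈ C)
    (hsmul : ∀ c : ℝ, 0 ≤ c → ∀ a ∈ C, c • a ∈ C) (hclosed : IsClosed C)
    (hred : ∀ᶠ z in 𝓝 (g x), z ∈ K ↔ Φ z ∈ C)
    (hmin : IsLocalMinOn f {y | g y ∈ K} x)
    (hrank : ∀ F, IsFace C F → ∃ r : ℕ, ∀ᶠ y in 𝓝 x, Module.finrank ℝ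
      ((Submodule.span ℝ F)ᗮ.map
        (ContinuousLinearMap.adjoint (fderiv ℝ (fun y => Φ (g y)) y)).toLinearMap) = r)
    {η : Y} (hη : ∀ z ∈ C, ⟪η, z⟫_ℝ ≤ 0)
    (hKKT : ∀ v, fderiv ℝ f x v + ⟪η, fderiv ℝ Φ (g x) (fderiv ℝ g x v)⟫_ℝ = 0)
    {d : X} (hd : fderiv ℝ g x d ∈ posTangentConeAt K (g x)) (hfd : fderiv ℝ f x d = 0)
    {w : E} (hw : w ∈ secondOrderTangentSet K (g x) (fderiv ℝ g x d)) :
    ⟪η, fderiv ℝ Φ (g x) w⟫_ℝ ≤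
      fderiv ℝ (fderiv ℝ f) x d d + ⟪η, fderiv ℝ Φ (g x) (fderiv ℝ (fderiv ℝ g) x d d)⟫_ℝ := by
  set A := fderiv ℝ Φ (g x) with hA
  set y := A (fderiv ℝ g x d) with hy
  have hΦd : HasFDerivAt Φ A (g x) := (hΦ.differentiableAt (by norm_num)).hasFDerivAt
  have hgd : HasFDerivAt g (fderiv ℝ g x) x := (hg.differentiable (by norm_num) x).hasFDerivAt
  have hGd : HasFDerivAt (fun y => Φ (g y)) (A.comp (fderiv ℝ g x)) x := hΦd.comp x hgd
  have hGc : ContDiffAt ℝ 2 (fun y => Φ (g y)) x := hΦ.comp x hg.contDiffAt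
  -- If `cₙeₙ → Dg(x)d` with `g(x) + eₙ ∈ K`, then `cₙΦ(g(x) + eₙ)` lies in `C` and tends to `y`.
  have hyC : y ∈ C := by
    obtain ⟨ι, l, hl, c, e, he0, he, hce⟩ := exists_fun_of_mem_tangentConeAt hd
    have hce' : Tendsto (fun n => (c n : ℝ) • e n) l (𝓝 (fderiv ℝ g x d)) := hce
    have hlim := hΦd.hasFDerivWithinAt.lim (s := Set.univ) he0 (by simp) hce'
    refine hclosed.mem_of_tendsto hlim ?_
    have hto : Tendsto (fun n => g x + e n) l (𝓝 (g x)) := by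
      simpa using tendsto_const_nhds.add he0
    filter_upwards [he, hto.eventually hred] with n hn hr
    rw [hΦ0, sub_zero]
    exact hsmul _ (c n).coe_nonneg _ (hr.1 hn)
  have hηy : ⟪η, y⟫_ℝ = 0 := by have := hKKT d; rw [hfd, zero_add] at this; exact this
  set U := Submodule.span ℝ (minimalFace C y) with hU
  obtain ⟨r, hr⟩ := hrank _ (isFace_minimalFace hadd hsmul hyC)
  have hyU : y ∈ U := Submodule.subset_span (mem_minimalFace_self hsmul hyC)
  have hηU : ∀ z ∈ U, ⟪η, z⟫_ℝ = 0 := fun z hz => by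
    induction hz using Submodule.span_induction with
    | mem z hz => exact inner_eq_zero_of_mem_minimalFace hη hηy hz
    | zero => simp
    | add a b _ _ ha hb => rw [inner_add_right, ha, hb, add_zero]
    | smul c a _ ha => rw [inner_smul_right, ha, mul_zero]
  obtain ⟨ξ, hξ0, hξd, hξU⟩ := exists_curve_of_constant_rank_orthogonal
    (hGc.of_le (by norm_num)) U hr (d := d) (by rw [hGd.fderiv]; exact hyU)
  simp only [hΦ0, sub_zero] at hξU
  have hξc : Tendsto ξ (𝓝 0) (𝓝 x) := by
    have := hξd.continuousAt.tendsto
    rwa [hξ0] at this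
  -- `t⁻¹Φ(g(ξ(t)))` stays in `U` and tends to `y`, a relative interior point of its minimal face;
  -- so it enters `C`.
  have hξK : ∀ᶠ t in 𝓝[>] (0 : ℝ), g (ξ t) ∈ K := by
    have h1 : HasDerivAt (fun t => Φ (g (ξ t))) y 0 :=
      HasFDerivAt.comp_hasDerivAt_of_eq (l := fun y => Φ (g y)) (0 : ℝ) hGd hξd hξ0.symm
    have h2 : Tendsto (fun t : ℝ => t⁻¹ • Φ (g (ξ t)) - y) (𝓝[>] 0) (𝓝 0) := by
      have h3 := (hasDerivAt_iff_tendsto_slope.1 h1).mono_left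
        (nhdsWithin_mono (0 : ℝ) fun t (ht : 0 < t) => ne_of_gt ht)
      have h4 := h3.sub_const y
      rw [sub_self] at h4
      refine h4.congr fun t => ?_
      simp [slope_def_module, hξ0, hΦ0]
    have hgξ : Tendsto (fun t => g (ξ t)) (𝓝[>] 0) (𝓝 (g x)) :=
      (hg.continuous.tendsto x).comp (hξc.mono_left nhdsWithin_le_nhds)
    filter_upwards [h2.eventually (eventually_add_mem_of_mem_span hadd hsmul hyC),
      hgξ.eventually hred, hξU.filter_mono nhdsWithin_le_nhds, self_mem_nhdsWithin]
      with t h3 h4 h5 (ht : 0 < t)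
    rw [h4]
    have h6 := hsmul t ht.le _ (h3 (U.sub_mem (U.smul_mem _ h5) hyU))
    rwa [add_sub_cancel, smul_smul, mul_inv_cancel₀ ht.ne', one_smul] at h6
  have hξmin : ∀ᶠ t in 𝓝[>] (0 : ℝ), f x ≤ f (ξ t) :=
    (tendsto_nhdsWithin_iff.2 ⟨hξc.mono_left nhdsWithin_le_nhds, hξK⟩).eventually hmin
  -- The Lagrangian along the curve and along the tangent line.
  let Lag : X → ℝ := fun y => f y + ⟪η, Φ (g y)⟫_ℝ
  have hLc : ContDiffAt ℝ 2 Lag x := hf.contDiffAt.add (contDiffAt_const.inner ℝ hGc)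
  have hL0 : fderiv ℝ Lag x = 0 := by
    have h1 : HasFDerivAt (fun y => ⟪η, Φ (g y)⟫_ℝ) ((innerSL ℝ η).comp (A.comp (fderiv ℝ g x))) x :=
      (innerSL ℝ η).hasFDerivAt.comp x hGd
    have h2 := ((hf.differentiable (by norm_num) x).hasFDerivAt.add h1).fderiv
    refine h2.trans (ContinuousLinearMap.ext fun v => ?_)
    simpa using hKKT v
  have hξo : (fun t => ξ t - (x + t • d)) =o[𝓝 0] fun t : ℝ => t := by
    have := hasDerivAt_iff_isLittleO.1 hξd
    simpa [hξ0, sub_sub] using this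
  have hlineO : (fun t : ℝ => x + t • d - x) =O[𝓝 0] fun t : ℝ => t := by
    refine Asymptotics.IsBigO.of_bound ‖d‖ (.of_forall fun t => ?_)
    simp [norm_smul, mul_comm]
  have hLo : (fun t => Lag (ξ t) - Lag (x + t • d)) =o[𝓝 0] fun t : ℝ => t ^ 2 := by
    refine isLittleO_sq_of_fderiv_eq_zero hLc hL0 le_rfl ?_ hlineO hξo
    exact (hξo.isBigO.add hlineO).congr_left fun t => by abel
  have hfo := taylor_two_along_line hf x d
  have hgo := taylor_two_along_line hg x d
  -- The given second-order path in `K`.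
  obtain ⟨ρ, hρ, hρK⟩ := hw
  set p : ℝ → E := fun t => g x + t • fderiv ℝ g x d + (t ^ 2 / 2) • w + ρ t with hp
  set b := fderiv ℝ (fderiv ℝ g) x d d with hb
  have hpg : (fun t => p t - g (x + t • d) - (t ^ 2 / 2) • (w - b)) =o[𝓝[>] 0]
      fun t : ℝ => t ^ 2 := by
    refine (hρ.sub (hgo.mono nhdsWithin_le_nhds)).congr_left fun t => ?_
    simp only [hp]
    module
  have hsqO : (fun t : ℝ => (t ^ 2 / 2) • (w - b)) =O[𝓝[>] 0] fun t : ℝ => t ^ 2 := by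
    refine Asymptotics.IsBigO.of_bound ‖w - b‖ (.of_forall fun t => ?_)
    rw [norm_smul, mul_comm]
    gcongr
    rw [norm_div]
    have := norm_nonneg (t ^ 2)
    norm_num
    linarith [sq_nonneg t]
  have hpgO : (fun t => p t - g (x + t • d)) =O[𝓝[>] 0] fun t : ℝ => t ^ 2 := by
    simpa using hpg.isBigO.add hsqO
  have hsq0 : Tendsto (fun t : ℝ => t ^ 2) (𝓝[>] 0) (𝓝 0) := by
    have : Continuous fun t : ℝ => t ^ 2 := by fun_prop
    simpa using (this.tendsto 0).mono_left nhdsWithin_le_nhds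
  have hgl : Tendsto (fun t : ℝ => g (x + t • d)) (𝓝[>] 0) (𝓝 (g x)) := by
    have : Continuous fun t : ℝ => g (x + t • d) := hg.continuous.comp (by fun_prop)
    simpa using (this.tendsto 0).mono_left nhdsWithin_le_nhds
  have hpl : Tendsto p (𝓝[>] 0) (𝓝 (g x)) := by
    simpa using (hpgO.trans_tendsto hsq0).add hgl
  -- Strict differentiability compares two moving points: they differ by `O(t²)`, so linearizing `Φ`
  -- between them costs only `o(t²)`.
  have hstrict := (hΦ.hasStrictFDerivAt (by norm_num)).isLittleO
  have hΦo : (fun t => Φ (p t) - Φ (g (x + t • d)) - A (p t - g (x + t • d))) =o[𝓝[>] 0]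
      fun t : ℝ => t ^ 2 :=
    (hstrict.comp_tendsto (hpl.prodMk_nhds hgl)).trans_isBigO hpgO
  have hΦo2 : (fun t => Φ (p t) - Φ (g (x + t • d)) - (t ^ 2 / 2) • A (w - b)) =o[𝓝[>] 0]
      fun t : ℝ => t ^ 2 := by
    refine (hΦo.add ((A.isBigO_comp _ _).trans_isLittleO hpg)).congr_left fun t => ?_
    simp only [map_sub, map_smul]
    abel
  have hinner : (fun t => ⟪η, Φ (p t)⟫_ℝ - ⟪η, Φ (g (x + t • d))⟫_ℝ
      - t ^ 2 / 2 * ⟪η, A (w - b)⟫_ℝ) =o[𝓝[>] 0] fun t : ℝ => t ^ 2 := by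
    refine (((innerSL ℝ η).isBigO_comp _ _).trans_isLittleO hΦo2).congr_left fun t => ?_
    simp [inner_sub_right, inner_smul_right]
  have hpC : ∀ᶠ t in 𝓝[>] (0 : ℝ), Φ (p t) ∈ C := by
    filter_upwards [hpl.eventually hred, self_mem_nhdsWithin] with t h1 (ht : 0 < t)
    exact h1.1 (hρK t ht)
  -- In this combination the values of `f` and `Φ ∘ g` on the line `x + td` cancel. What remains is
  -- at least `κt²/2` by minimality and polarity, against an error of at most `κt²/4`.
  have htotal : (fun t : ℝ => (f (x + t • d) - f x - t • fderiv ℝ f x d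
      - (t ^ 2 / 2) • fderiv ℝ (fderiv ℝ f) x d d) + (Lag (ξ t) - Lag (x + t • d))
      - (⟪η, Φ (p t)⟫_ℝ - ⟪η, Φ (g (x + t • d))⟫_ℝ - t ^ 2 / 2 * ⟪η, A (w - b)⟫_ℝ))
      =o[𝓝[>] 0] fun t : ℝ => t ^ 2 :=
    ((hfo.mono nhdsWithin_le_nhds).add (hLo.mono nhdsWithin_le_nhds)).sub hinner
  by_contra! hcon
  set κ := ⟪η, A w⟫_ℝ - (fderiv ℝ (fderiv ℝ f) x d d + ⟪η, A b⟫_ℝ) with hκ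
  have hκ0 : 0 < κ := by rw [hκ]; linarith
  obtain ⟨t, h1, h2, h3, h4, h5⟩ := ((htotal.bound (show 0 < κ / 4 by positivity)).and
    (hξmin.and (hpC.and ((hξU.filter_mono nhdsWithin_le_nhds).and
      (self_mem_nhdsWithin (s := Set.Ioi (0 : ℝ))))))).exists
  have ht : 0 < t := h5
  have h6 := hη _ h3
  have h7 := hηU _ h4
  rw [Real.norm_eq_abs, Real.norm_eq_abs, abs_of_nonneg (sq_nonneg t)] at h1
  have h8 := (le_abs_self _).trans h1
  have h9 : 0 < t ^ 2 := by positivity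
  simp only [Lag, hfd, h7, smul_eq_mul, map_sub, inner_sub_right] at h8
  nlinarith

end Reducible

end NSOCP

namespace NSOCP

/-! ### Auxiliary facts on derivatives and polars. -/

theorem hasFDerivAt_norm {E : Type*} [NormedAddCommGroup E] [InnerProductSpace ℝ E] {z : E}
    (hz : z ≠ 0) : HasFDerivAt (fun z : E => ‖z‖) (‖z‖⁻¹ • innerSL ℝ z) z := by
  have hz' : ‖z‖ ≠ 0 := norm_ne_zero_iff.2 hz
  have h := (hasStrictFDerivAt_norm_sq z).hasFDerivAt.sqrt (by positivity)
  simp only [Real.sqrt_sq (norm_nonneg _)] at h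
  convert h using 1
  ext v
  simp
  field_simp

theorem fderiv_fderiv_clm_comp {X V W : Type*} [NormedAddCommGroup X] [NormedSpace ℝ X]
    [NormedAddCommGroup V] [NormedSpace ℝ V] [NormedAddCommGroup W] [NormedSpace ℝ W]
    (T : V →L[ℝ] W) {G : X → V} (hG : ContDiff ℝ 2 G) (x d₁ d₂ : X) :
    fderiv ℝ (fderiv ℝ fun y => T (G y)) x d₁ d₂ = T (fderiv ℝ (fderiv ℝ G) x d₁ d₂) := by
  have h1 : (fderiv ℝ fun y => T (G y)) = fun y => T.comp (fderiv ℝ G y) := funext fun y =>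
    (T.hasFDerivAt.comp y (hG.differentiable (by norm_num) y).hasFDerivAt).fderiv
  have h2 : DifferentiableAt ℝ (fderiv ℝ G) x :=
    (hG.fderiv_right (m := 1) (by norm_num)).differentiable (by norm_num) x
  rw [h1, ((hasFDerivAt_const T x).clm_comp h2.hasFDerivAt).fderiv]
  simp

/-- From an interior point one can step to `z + tμ ∈ S` with `t > 0`, and polarity then gives `t‖μ‖²
≤ 0`. -/
theorem eq_zero_of_mem_polar_of_mem_interior {E : Type*} [NormedAddCommGroup E]
    [InnerProductSpace ℝ E] {S : Set E} {z μ : E} (hz : z ∈ interior S) (hμ : μ ∈ polar S)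
    (h : ⟪z, μ⟫_ℝ = 0) : μ = 0 := by
  have hc : Tendsto (fun t : ℝ => z + t • μ) (𝓝[>] 0) (𝓝 z) := by
    have : Continuous fun t : ℝ => z + t • μ := by fun_prop
    simpa using (this.tendsto 0).mono_left nhdsWithin_le_nhds
  obtain ⟨t, ht, ht0⟩ := ((hc.eventually (mem_interior_iff_mem_nhds.1 hz)).and
    (self_mem_nhdsWithin (s := Set.Ioi (0 : ℝ)))).exists
  have h1 := hμ _ ht
  rw [inner_add_right, inner_smul_right, real_inner_comm, h, zero_add] at h1
  have h2 : ⟪μ, μ⟫_ℝ ≤ 0 := nonpos_of_mul_nonpos_right h1 ht0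
  rw [real_inner_self_eq_norm_sq] at h2
  simpa using h2

/-! ### Geometry of a single second-order cone. -/

section SecondOrderConeLemmas

variable {k : ℕ}

/-- The map `hat` as a continuous linear map. -/
noncomputable def hatCLM (k : ℕ) : Rn (k + 1) →L[ℝ] Rn k :=
  LinearMap.toContinuousLinearMap
    { toFun := hat
      map_add' := fun _ _ => rfl
      map_smul' := fun _ _ => rfl }

/-- The coordinate `z₀` as a continuous linear map. -/
noncomputable def headCLM (k : ℕ) : Rn (k + 1) →L[ℝ] ℝ := EuclideanSpace.proj 0

theorem inner_eq_head_add_hat (z w : Rn (k + 1)) :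
    ⟪z, w⟫_ℝ = z 0 * w 0 + ⟪hat z, hat w⟫_ℝ := by
  simp only [PiLp.inner_apply, Fin.sum_univ_succ, hat]
  simp [mul_comm]

/-- The vector `(a, u)`. -/
noncomputable def headHat (a : ℝ) (u : Rn k) : Rn (k + 1) :=
  WithLp.toLp 2 (Fin.cons a u.ofLp : Fin (k + 1) → ℝ)

theorem headHat_zero (a : ℝ) (u : Rn k) : headHat a u 0 = a := rfl

theorem hat_headHat (a : ℝ) (u : Rn k) : hat (headHat a u) = u := rfl

theorem add_mem_secondOrderCone {z w : Rn (k + 1)} (hz : z ∈ secondOrderCone k)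
    (hw : w ∈ secondOrderCone k) : z + w ∈ secondOrderCone k :=
  (norm_add_le (hat z) (hat w)).trans (add_le_add hz hw)

theorem smul_mem_secondOrderCone {c : ℝ} (hc : 0 ≤ c) {z : Rn (k + 1)}
    (hz : z ∈ secondOrderCone k) : c • z ∈ secondOrderCone k := by
  have h : ‖c • hat z‖ ≤ c * z 0 := by
    rw [norm_smul, Real.norm_of_nonneg hc]
    exact mul_le_mul_of_nonneg_left hz hc
  exact h

theorem continuous_norm_hat : Continuous fun z : Rn (k + 1) => ‖hat z‖ := (hatCLM k).continuous.norm

theorem isClosed_secondOrderCone : IsClosed (secondOrderCone k) :=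
  isClosed_le continuous_norm_hat (headCLM k).continuous

theorem head_eq_norm_hat_of_mem_frontier {z : Rn (k + 1)} (hz : z ∈ frontier (secondOrderCone k)) :
    z 0 = ‖hat z‖ :=
  (frontier_le_subset_eq continuous_norm_hat (headCLM k).continuous hz).symm

theorem hat_ne_zero_of_mem_frontier {z : Rn (k + 1)}
    (hz : z ∈ frontier (secondOrderCone k) \ {0}) : hat z ≠ 0 := by
  intro h
  have h0 := head_eq_norm_hat_of_mem_frontier hz.1
  rw [h, norm_zero] at h0
  refine hz.2 (inner_self_eq_zero (𝕜 := ℝ).1 ?_)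
  rw [inner_eq_head_add_hat, h, h0]
  simp

theorem mem_interior_secondOrderCone {z : Rn (k + 1)} (hz : z ∈ secondOrderCone k) (h0 : z ≠ 0)
    (hfr : z ∉ frontier (secondOrderCone k) \ {0}) : z ∈ interior (secondOrderCone k) := by
  by_contra hi
  exact hfr ⟨⟨subset_closure hz, hi⟩, h0⟩

theorem head_nonpos_of_mem_polar {μ : Rn (k + 1)} (hμ : μ ∈ polar (secondOrderCone k)) :
    μ 0 ≤ 0 := by
  have h := hμ (headHat 1 0) (by simp [secondOrderCone, hat_headHat, headHat_zero])
  simpa [inner_eq_head_add_hat, hat_headHat, headHat_zero] using h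

/-- A multiplier of a nonzero boundary point `z` of the second-order cone is a multiple of the
gradient of `z ↦ z₀ - ‖ẑ‖`. -/
theorem hat_eq_of_mem_polar {z μ : Rn (k + 1)} (hz : z 0 = ‖hat z‖) (hz0 : hat z ≠ 0)
    (hμ : μ ∈ polar (secondOrderCone k)) (h : ⟪z, μ⟫_ℝ = 0) :
    hat μ = -(μ 0 * ‖hat z‖⁻¹) • hat z := by
  have hzn : 0 < ‖hat z‖ := norm_pos_iff.2 hz0
  have hμ0 := head_nonpos_of_mem_polar hμ
  rw [inner_eq_head_add_hat, hz] at h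
  have hle : ‖hat μ‖ ≤ -(μ 0) := by
    have h1 := hμ (headHat ‖hat μ‖ (hat μ)) (by simp [secondOrderCone, hat_headHat, headHat_zero])
    rw [inner_eq_head_add_hat, hat_headHat, headHat_zero, real_inner_self_eq_norm_sq] at h1
    rcases (norm_nonneg (hat μ)).eq_or_lt with h2 | h2
    · rw [← h2]; linarith
    · by_contra! h3
      nlinarith
  -- The equality case of Cauchy–Schwarz: by complementarity this square equals `‖ẑ‖²(‖μ̂‖² - μ₀²)`.
  have hsq : ‖‖hat z‖ • hat μ + μ 0 • hat z‖ ^ 2 ≤ 0 := by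
    rw [norm_add_sq_real, inner_smul_left, inner_smul_right, norm_smul, norm_smul, norm_norm,
      Real.norm_eq_abs, mul_pow, mul_pow, sq_abs, real_inner_comm]
    have h1 : ⟪hat z, hat μ⟫_ℝ = -(‖hat z‖ * μ 0) := by linarith
    rw [h1]
    have h2 : ‖hat μ‖ ^ 2 ≤ (μ 0) ^ 2 := by nlinarith [norm_nonneg (hat μ)]
    simp only [conj_trivial]
    nlinarith [mul_le_mul_of_nonneg_left h2 (sq_nonneg ‖hat z‖)]
  have h0 : ‖hat z‖ • hat μ + μ 0 • hat z = 0 := by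
    rw [← norm_eq_zero, ← sq_eq_zero_iff]
    exact le_antisymm hsq (sq_nonneg _)
  have h1 := congrArg (fun v => ‖hat z‖⁻¹ • v) h0
  simp only [smul_add, smul_smul, inv_mul_cancel₀ hzn.ne', one_smul, smul_zero] at h1
  rw [eq_neg_of_add_eq_zero_left h1, neg_smul, mul_comm]

end SecondOrderConeLemmas

/-! ### Reduction of the product cone at `g(x̄)`. -/

section Reduction

variable {n q : ℕ} {m : Fin q → ℕ}

/-- The map whose composition with `productMap g` is the reduced constraint map. -/
noncomputable def reduction (g : ∀ j : Fin q, Rn n → Rn (m j + 1)) (xbar : Rn n)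
    (z : ProductSpace m) :
    ReducedSpace g xbar :=
  WithLp.toLp 2
    (WithLp.toLp 2 fun j : indexZero g xbar => z j,
     WithLp.toLp 2 fun j : indexBdry g xbar => z j 0 - ‖hat (z j)‖)

/-- The multiplier of the reduced problem that corresponds to `lam`. -/
noncomputable def reducedMultiplier (g : ∀ j : Fin q, Rn n → Rn (m j + 1)) (xbar : Rn n)
    (lam : ProductSpace m) : ReducedSpace g xbar :=
  WithLp.toLp 2
    (WithLp.toLp 2 fun j : indexZero g xbar => lam j,
     WithLp.toLp 2 fun j : indexBdry g xbar => lam j 0)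

variable {g : ∀ j : Fin q, Rn n → Rn (m j + 1)} {xbar : Rn n}

theorem mem_indexZero {j : Fin q} : j ∈ indexZero g xbar ↔ g j xbar = 0 := by
  simp [indexZero]

theorem mem_indexBdry {j : Fin q} :
    j ∈ indexBdry g xbar ↔ g j xbar ∈ frontier (secondOrderCone (m j)) \ {0} := by
  simp [indexBdry]

theorem inner_reducedMultiplier (lam : ProductSpace m) (y : ReducedSpace g xbar) :
    ⟪reducedMultiplier g xbar lam, y⟫_ℝ =
      (∑ j : indexZero g xbar, ⟪lam j, y.fst j⟫_ℝ) + ∑ j : indexBdry g xbar, lam j 0 * y.snd j := by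
  rw [WithLp.prod_inner_apply, PiLp.inner_apply, PiLp.inner_apply]
  simp [reducedMultiplier, mul_comm]

/-- The norm is smooth away from `0`, and `ẑ ≠ 0` at a boundary point other than the vertex. -/
theorem contDiffAt_reduction : ContDiffAt ℝ 2 (reduction g xbar) (productMap g xbar) := by
  refine ((WithLp.prodContinuousLinearEquiv 2 ℝ (PiLp 2 fun j : indexZero g xbar => Rn (m j + 1))
    (EuclideanSpace ℝ (indexBdry g xbar))).symm.contDiff.contDiffAt).comp _
    (ContDiffAt.prodMk ?_ ?_)
  · refine (contDiffAt_piLp 2).2 fun j => ?_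
    exact (PiLp.proj 2 (fun j : Fin q => Rn (m j + 1)) j.1 : _ →L[ℝ] _).contDiff.contDiffAt
  · refine (contDiffAt_piLp 2).2 fun j => ?_
    let T : ProductSpace m →L[ℝ] Rn (m j.1 + 1) := PiLp.proj 2 (fun j : Fin q => Rn (m j + 1)) j.1
    have h1 : ContDiffAt ℝ 2 (fun z : ProductSpace m => (headCLM _).comp T z)
      (productMap g xbar) := ContinuousLinearMap.contDiff _ |>.contDiffAt
    have h2 : ContDiffAt ℝ 2 (fun z : ProductSpace m => ‖(hatCLM _).comp T z‖)
      (productMap g xbar) := (ContinuousLinearMap.contDiff _ |>.contDiffAt).norm ℝ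
        (hat_ne_zero_of_mem_frontier (mem_indexBdry.1 j.2))
    exact h1.sub h2

theorem reduction_productMap : reduction g xbar (productMap g xbar) = 0 := by
  refine (WithLp.ofLp_injective 2) (Prod.ext ?_ ?_)
  · ext j : 1
    exact mem_indexZero.1 j.2
  · ext j : 1
    exact sub_eq_zero.2 (head_eq_norm_hat_of_mem_frontier (mem_indexBdry.1 j.2).1)

theorem mem_polar_secondOrderCone {lam : ProductSpace m} (hlam : lam ∈ polar (productCone m))
    (j : Fin q) : lam j ∈ polar (secondOrderCone (m j)) := by
  intro y hy
  have h := hlam (WithLp.toLp 2 (Pi.single j y)) (fun i => ?_)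
  · rw [PiLp.inner_apply, Finset.sum_eq_single j] at h
    · simpa using h
    · intro i _ hij
      simp [Pi.single_eq_of_ne hij]
    · simp
  · rcases eq_or_ne i j with rfl | hij
    · simpa using hy
    · simp only [Pi.single_eq_of_ne hij]
      simpa using smul_mem_secondOrderCone le_rfl
        (show headHat 0 0 ∈ secondOrderCone (m i) by
          simp [secondOrderCone, hat_headHat, headHat_zero])

theorem inner_block_eq_zero (hfeas : productMap g xbar ∈ productCone m) {lam : ProductSpace m}
    (hlam : lam ∈ polar (productCone m)) (h : ⟪productMap g xbar, lam⟫_ℝ = 0) (j : Fin q) :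
    ⟪g j xbar, lam j⟫_ℝ = 0 := by
  rw [PiLp.inner_apply] at h
  refine (Finset.sum_eq_zero_iff_of_nonpos fun i _ => ?_).1 h j (Finset.mem_univ j)
  rw [real_inner_comm]
  exact mem_polar_secondOrderCone hlam i _ (hfeas i)

theorem inner_reducedMultiplier_nonpos {lam : ProductSpace m} (hlam : lam ∈ polar (productCone m))
    {y : ReducedSpace g xbar} (hy : y ∈ reducedCone g xbar) :
    ⟪reducedMultiplier g xbar lam, y⟫_ℝ ≤ 0 := by
  rw [inner_reducedMultiplier]
  refine add_nonpos (Finset.sum_nonpos fun j _ => ?_) (Finset.sum_nonpos fun j _ => ?_)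
  · exact mem_polar_secondOrderCone hlam j _ (hy.1 j)
  · exact mul_nonpos_of_nonpos_of_nonneg
      (head_nonpos_of_mem_polar (mem_polar_secondOrderCone hlam j)) (hy.2 j)

theorem isClosed_reducedCone : IsClosed (reducedCone g xbar) := by
  have h1 : Continuous fun y : ReducedSpace g xbar => y.fst := WithLp.prod_continuous_ofLp 2 _ _ |>.fst
  have h2 : Continuous fun y : ReducedSpace g xbar => y.snd := WithLp.prod_continuous_ofLp 2 _ _ |>.snd
  have h3 : IsClosed (⋂ j : indexZero g xbar,
      (fun y : ReducedSpace g xbar => y.fst j) ⁻¹' secondOrderCone (m j)) :=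
    isClosed_iInter fun j => isClosed_secondOrderCone.preimage
      ((PiLp.continuous_apply 2 _ j).comp h1)
  have h4 : IsClosed (⋂ j : indexBdry g xbar,
      (fun y : ReducedSpace g xbar => y.snd j) ⁻¹' Set.Ici 0) :=
    isClosed_iInter fun j => isClosed_Ici.preimage ((PiLp.continuous_apply 2 _ j).comp h2)
  convert h3.inter h4 using 1
  ext y
  simp [reducedCone]

/-- Near `g(x)`, membership in the product cone is membership of the reduction in the reduced
cone. -/
theorem eventually_mem_productCone_iff (hfeas : productMap g xbar ∈ productCone m) :
    ∀ᶠ z in 𝓝 (productMap g xbar), z ∈ productCone m ↔ reduction g xbar z ∈ reducedCone g xbar := by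
  have h : ∀ᶠ z in 𝓝 (productMap g xbar), ∀ j, j ∉ indexZero g xbar → j ∉ indexBdry g xbar →
      z j ∈ secondOrderCone (m j) := by
    refine eventually_all.2 fun j => ?_
    by_cases h0 : j ∈ indexZero g xbar
    · exact .of_forall fun z h => absurd h0 h
    by_cases hB : j ∈ indexBdry g xbar
    · exact .of_forall fun z _ h => absurd hB h
    have hi := mem_interior_secondOrderCone (hfeas j) (mt mem_indexZero.2 h0) (mt mem_indexBdry.2 hB)
    have hc : Tendsto (fun z : ProductSpace m => z j) (𝓝 (productMap g xbar)) (𝓝 (g j xbar)) :=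
      (PiLp.continuous_apply 2 _ j).tendsto (productMap g xbar)
    exact (hc.eventually (mem_interior_iff_mem_nhds.1 hi)).mono fun z hz _ _ => hz
  filter_upwards [h] with z hz
  constructor
  · exact fun hzK => ⟨fun j => hzK j, fun j => sub_nonneg.2 (hzK j)⟩
  · rintro ⟨h1, h2⟩ j
    by_cases h0 : j ∈ indexZero g xbar
    · exact h1 ⟨j, h0⟩
    by_cases hB : j ∈ indexBdry g xbar
    · exact sub_nonneg.1 (h2 ⟨j, hB⟩)
    exact hz j h0 hB

/-- This is `DΦᵀη = λ`, block by block: `Φ` is the identity on vertex blocks, `λ_j` is `λ_{j,0}`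
times the gradient of `z₀ - ‖ẑ‖` on boundary blocks, and `λ_j = 0` on interior blocks, which `Φ`
drops. -/
theorem inner_reducedMultiplier_fderiv (hfeas : productMap g xbar ∈ productCone m)
    {lam : ProductSpace m} (hlam : lam ∈ polar (productCone m))
    (h : ⟪productMap g xbar, lam⟫_ℝ = 0) (v : ProductSpace m) :
    ⟪reducedMultiplier g xbar lam, fderiv ℝ (reduction g xbar) (productMap g xbar) v⟫_ℝ =
      ⟪lam, v⟫_ℝ := by
  have hd := (contDiffAt_reduction (g := g) (xbar := xbar)).differentiableAt (by norm_num)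
  have h1 := (innerSL ℝ (reducedMultiplier g xbar lam)).hasFDerivAt.comp (productMap g xbar)
    hd.hasFDerivAt
  let T : ∀ j : Fin q, ProductSpace m →L[ℝ] Rn (m j + 1) := fun j =>
    PiLp.proj 2 (fun j : Fin q => Rn (m j + 1)) j
  have h2 : HasFDerivAt (fun z => (∑ j : indexZero g xbar, ⟪lam j, T j z⟫_ℝ) +
      ∑ j : indexBdry g xbar, lam j 0 * (headCLM _ (T j z) - ‖hatCLM _ (T j z)‖))
      ((∑ j : indexZero g xbar, (innerSL ℝ (lam j)).comp (T j)) +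
        ∑ j : indexBdry g xbar, lam j 0 • ((headCLM _).comp (T j) -
          (‖hat (g j xbar)‖⁻¹ • innerSL ℝ (hat (g j xbar))).comp ((hatCLM _).comp (T j))))
      (productMap g xbar) := by
    refine HasFDerivAt.fun_add
      (HasFDerivAt.fun_sum fun j _ => ((innerSL ℝ (lam j)).comp (T j)).hasFDerivAt)
      (HasFDerivAt.fun_sum fun j _ => HasFDerivAt.const_mul ?_ _)
    refine ((headCLM _).comp (T j)).hasFDerivAt.sub ?_
    exact HasFDerivAt.comp (productMap g xbar) (g := fun z : Rn (m j) => ‖z‖)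
      (hasFDerivAt_norm (hat_ne_zero_of_mem_frontier (mem_indexBdry.1 j.2)))
      ((hatCLM _).comp (T j)).hasFDerivAt
  have h3 : (fun z => (∑ j : indexZero g xbar, ⟪lam j, T j z⟫_ℝ) +
      ∑ j : indexBdry g xbar, lam j 0 * (headCLM _ (T j z) - ‖hatCLM _ (T j z)‖)) =
      innerSL ℝ (reducedMultiplier g xbar lam) ∘ reduction g xbar := by
    funext z
    exact (inner_reducedMultiplier lam (reduction g xbar z)).symm
  rw [h3] at h2
  have h4 := DFunLike.congr_fun (h1.unique h2) v
  refine h4.trans ?_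
  have h5 : ∀ j ∈ indexBdry g xbar, lam j 0 * (v j 0 -
      ‖hat (g j xbar)‖⁻¹ * ⟪hat (g j xbar), hat (v j)⟫_ℝ) = ⟪lam j, v j⟫_ℝ := by
    intro j hj
    rw [mem_indexBdry] at hj
    rw [inner_eq_head_add_hat, hat_eq_of_mem_polar (head_eq_norm_hat_of_mem_frontier hj.1)
      (hat_ne_zero_of_mem_frontier hj) (mem_polar_secondOrderCone hlam j)
      (inner_block_eq_zero hfeas hlam h j), inner_smul_left]
    simp only [conj_trivial]
    ring
  have h6 : ⟪lam, v⟫_ℝ = ∑ j ∈ indexZero g xbar ∪ indexBdry g xbar, ⟪lam j, v j⟫_ℝ := by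
    rw [PiLp.inner_apply]
    refine (Finset.sum_subset (Finset.subset_univ _) fun j _ hj => ?_).symm
    rw [Finset.notMem_union, mem_indexZero, mem_indexBdry] at hj
    rw [eq_zero_of_mem_polar_of_mem_interior
      (mem_interior_secondOrderCone (hfeas j) hj.1 hj.2) (mem_polar_secondOrderCone hlam j)
      (inner_block_eq_zero hfeas hlam h j), inner_zero_left]
  have hdisj : Disjoint (indexZero g xbar) (indexBdry g xbar) :=
    Finset.disjoint_left.2 fun j h0 hB => (mem_indexBdry.1 hB).2 (mem_indexZero.1 h0)
  rw [h6, Finset.sum_union hdisj, ← Finset.sum_coe_sort (indexZero g xbar),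
    ← Finset.sum_coe_sort (indexBdry g xbar)]
  simp only [add_apply, sum_apply]
  exact congrArg₂ (· + ·) rfl (Finset.sum_congr rfl fun j _ => h5 j j.2)

end Reduction

end NSOCP

/-! ### The theorem for second-order cones. -/

open NSOCP in
theorem mainTheorem1 {n q : ℕ} (m : Fin q → ℕ)
    (f : Rn n → ℝ) (hf : ContDiff ℝ 2 f)
    (g : ∀ j : Fin q, Rn n → Rn (m j + 1)) (hg : ∀ j, ContDiff ℝ 2 (g j))
    (xbar : Rn n) (hfeas : xbar ∈ feasibleSet (productCone m) (productMap g))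
    (hmin : IsLocalMinOn f (feasibleSet (productCone m) (productMap g)) xbar)
    (hfcr : FacialConstantRank g xbar) :
    ∀ lam ∈ lagrangeMultipliers f (productCone m) (productMap g) xbar,
      ∀ d ∈ criticalCone f (productCone m) (productMap g) xbar,
        (0 : EReal) ≤
          ((secondDeriv f xbar d d +
            ∑ j : Fin q, ⟪secondDeriv (g j) xbar d d, lam j⟫_ℝ : ℝ) : EReal) -
          sigmaTerm (productCone m) (productMap g) d xbar lam := by
  rintro lam ⟨hpol, hstat, hcompl⟩ d ⟨hd, hfd⟩
  have hfd' : ∀ v, ⟪gradient f xbar, v⟫_ℝ = fderiv ℝ f xbar v := fun v => by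
    simp [gradient]
  have hgc : ContDiff ℝ 2 (productMap g) := (contDiff_piLp 2).2 hg
  have hpair := inner_reducedMultiplier_fderiv (g := g) (xbar := xbar) hfeas hpol hcompl
  have hsecond : ∑ j : Fin q, ⟪secondDeriv (g j) xbar d d, lam j⟫_ℝ =
      ⟪lam, fderiv ℝ (fderiv ℝ (productMap g)) xbar d d⟫_ℝ := by
    rw [PiLp.inner_apply]
    refine Finset.sum_congr rfl fun j _ => ?_
    rw [real_inner_comm]
    congr 1
    exact fderiv_fderiv_clm_comp (PiLp.proj 2 (fun j : Fin q => Rn (m j + 1)) j) hgc xbar d d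
  -- The minuend is finite, so the claim is an upper bound on the supremum, even if that is
  -- infinite; each `w` is then treated separately.
  rw [EReal.sub_nonneg (Or.inl (EReal.coe_ne_top _)) (Or.inl (EReal.coe_ne_bot _))]
  refine iSup₂_le fun w hw => EReal.coe_le_coe_iff.2 ?_
  rw [real_inner_comm, hsecond, ← hpair, ← hpair]
  obtain ⟨V, hV, hrank⟩ := hfcr
  refine inner_secondOrderTangent_le_of_constant_rank (C := reducedCone g xbar) hf hgc
    contDiffAt_reduction reduction_productMap ?_ ?_ isClosed_reducedCone
    (eventually_mem_productCone_iff hfeas) hmin ?_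
    (fun z hz => inner_reducedMultiplier_nonpos hpol hz) ?_ hd (by rw [← hfd']; exact hfd) hw
  · exact fun a ha b hb => ⟨fun j => add_mem_secondOrderCone (ha.1 j) (hb.1 j),
      fun j => add_nonneg (ha.2 j) (hb.2 j)⟩
  · exact fun c hc a ha => ⟨fun j => smul_mem_secondOrderCone hc (ha.1 j),
      fun j => mul_nonneg hc (ha.2 j)⟩
  -- `reducedMap g xbar` unfolds to `reduction g xbar` after `productMap g`, so the rank hypothesis
  -- applies as it stands.
  · intro F hF
    obtain ⟨r, hr⟩ := hrank F hF
    exact ⟨r, Filter.eventually_of_mem hV hr⟩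
  · intro v
    rw [hpair, ← hfd', ← ContinuousLinearMap.adjoint_inner_left, ← inner_add_left, hstat,
      inner_zero_left]
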